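/- Let $R$ be an associative ring with identity; all modules are unital. For $R$-modules $A$ and $B$ (on the same side), $B$ is called $A$-subinjective if for every module $C$ containing $A$ as a submodule, every homomorphism $A\to B$ extends to a homomorphism $C\to B$; and $B$ is called $A$-subprojective if for every epimorphism $p\colon C\to A$ and every homomorphism $f\colon B\to A$ there is a homomorphism $g\colon B\to C$ with $p g=f$. The subinjectivity domain $\underline{\mathfrak{In}}^{-1}(B)$ (respectively subprojectivity domain $\underline{\mathfrak{Pr}}^{-1}(B)$) of $B$ is the class of all modules $A$ such that $B$ is $A$-subinjective (respectively $A$-subprojective). A module $M$ is called subinjective extension-reflecting (si.e.r.) if for every short exact sequence $0\to A\to B\to C\to 0$ of modules, $M\in\underline{\mathfrak{In}}^{-1}(A)\cap\underline{\mathfrak{In}}^{-1}(C)$ implies $M\in\underline{\mathfrak{In}}^{-1}(B)$; it is called subprojective extension-reflecting (sp.e.r.) if for every such sequence $M\in\underline{\mathfrak{Pr}}^{-1}(A)\cap\underline{\mathfrak{Pr}}^{-1}(C)$ implies $M\in\underline{\mathfrak{Pr}}^{-1}(B)$. Suppose that $R$ is a QF-ring, that is, $R$ is right noetherian and right self-injective.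 Then: 1. every right $R$-module is si.e.r.; 2. every left $R$-module is si.e.r.; 3. every right $R$-module is sp.e.r.; 4. every left $R$-module is sp.e.r. -/

import Mathlib

universe u v

section ExtensionReflecting

/- Throughout, modules over a ring `S` are Mathlib's (unital, left) `S`-modules. Right modules over
a ring `R` are modules over the opposite ring `Rᵐᵒᵖ`, as usual in Mathlib. -/

/-- `B` is `A`-subinjective: for every extension `C` of `A` (given by an embedding `i : A → C`),
every homomorphism `A → B` extends to a homomorphism `C → B`.
Equivalently, `A` belongs to the subinjectivity domain of `B`. -/
def IsSubinjective (S : Type u) [Ring S] (A B : Type v) [AddCommGroup A] [Module S A]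
    [AddCommGroup B] [Module S B] : Prop :=
  ∀ (C : Type v) [AddCommGroup C] [Module S C] (i : A →ₗ[S] C), Function.Injective i →
    ∀ f : A →ₗ[S] B, ∃ g : C →ₗ[S] B, g ∘ₗ i = f

/-- `B` is `A`-subprojective: for every epimorphism `p : C → A`, every homomorphism `B → A` lifts
to a homomorphism `B → C`.
Equivalently, `A` belongs to the subprojectivity domain of `B`. -/
def IsSubprojective (S : Type u) [Ring S] (A B : Type v) [AddCommGroup A] [Module S A]
    [AddCommGroup B] [Module S B] : Prop :=
  ∀ (C : Type v) [AddCommGroup C] [Module S C] (p : C →ₗ[S] A), Function.Surjective p →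
    ∀ f : B →ₗ[S] A, ∃ g : B →ₗ[S] C, p ∘ₗ g = f

/-- `M` is subinjective extension-reflecting (si.e.r.): for every short exact sequence
`0 → A → B → C → 0`, if `M` lies in the subinjectivity domains of `A` and of `C`, then it lies in
the subinjectivity domain of `B`. -/
def IsSier (S : Type u) [Ring S] (M : Type v) [AddCommGroup M] [Module S M] : Prop :=
  ∀ (A B C : Type v) [AddCommGroup A] [AddCommGroup B] [AddCommGroup C]
    [Module S A] [Module S B] [Module S C] (i : A →ₗ[S] B) (p : B →ₗ[S] C),
    Function.Injective i → Function.Exact i p → Function.Surjective p →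
    IsSubinjective S M A → IsSubinjective S M C → IsSubinjective S M B

/-- `M` is subprojective extension-reflecting (sp.e.r.): for every short exact sequence
`0 → A → B → C → 0`, if `M` lies in the subprojectivity domains of `A` and of `C`, then it lies in
the subprojectivity domain of `B`. -/
def IsSper (S : Type u) [Ring S] (M : Type v) [AddCommGroup M] [Module S M] : Prop :=
  ∀ (A B C : Type v) [AddCommGroup A] [AddCommGroup B] [AddCommGroup C]
    [Module S A] [Module S B] [Module S C] (i : A →ₗ[S] B) (p : B →ₗ[S] C),
    Function.Injective i → Function.Exact i p → Function.Surjective p →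
    IsSubprojective S M A → IsSubprojective S M C → IsSubprojective S M B

/-- `R` is a QF-ring: it is right noetherian and right self-injective. -/
structure IsQFRing (R : Type u) [Ring R] : Prop where
  right_noetherian : IsNoetherian Rᵐᵒᵖ R
  right_selfInjective : Module.Injective Rᵐᵒᵖ R

end ExtensionReflecting

/-! Suppose free modules are injective and every module embeds in a free module. Extension along one
embedding `M → F`, with `F` projective and injective, then decides every subinjectivity question
about `M`, and dually for a surjection `F → M`; both claims become short diagram chases
(`isSier_of_injective`, `isSper_of_surjective`). The work is to obtain this on both sides from
one-sided hypotheses. Right self-injectivity turns the ACC on right annihilators into a DCC on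
principal left ideals, so `R` is semiprimary, hence right artinian. The double annihilator property
of finitely generated left ideals then makes `R` left noetherian. A counting argument on the
finitely many two-sided primes embeds every simple right module in `R`
(`IsTwoSidedPrime.exists_cyclicRightAnn_eq`), so `R` cogenerates right modules, which in turn gives
left self-injectivity. -/

/-- The right annihilator of a set, as a right ideal. -/
def rightAnn {R : Type u} [Ring R] (s : Set R) : Submodule Rᵐᵒᵖ R where
  carrier := {x | ∀ a ∈ s, a * x = 0}
  add_mem' hx hy a ha := by rw [mul_add, hx a ha, hy a ha, add_zero]
  zero_mem' a _ := mul_zero a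
  smul_mem' c x hx a ha := by
    rw [MulOpposite.smul_eq_mul_unop, ← mul_assoc, hx a ha, zero_mul]

/-- The left annihilator of a set, as a left ideal. -/
def leftAnn {R : Type u} [Ring R] (s : Set R) : Ideal R where
  carrier := {x | ∀ a ∈ s, x * a = 0}
  add_mem' hx hy a ha := by rw [add_mul, hx a ha, hy a ha, add_zero]
  zero_mem' a _ := zero_mul a
  smul_mem' c x hx a ha := by rw [smul_eq_mul, mul_assoc, hx a ha, mul_zero]

/-! ### From the DCC on principal left ideals to semiprimary rings. -/

/-- Every nonempty family of principal left ideals has a minimal member. -/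
def PrincipalDCC (R : Type u) [Ring R] : Prop :=
  ∀ P : R → Prop, (∃ a, P a) → ∃ a, P a ∧ ∀ c, P (c * a) → ∃ d, d * (c * a) = a

section

variable {R : Type u} [Ring R]

theorem rightAnn_anti {s t : Set R} (h : s ⊆ t) : rightAnn t ≤ rightAnn s :=
  fun _ hx a ha ↦ hx a (h ha)

theorem Submodule.mul_mem_of_op {I : Submodule Rᵐᵒᵖ R} {x : R} (hx : x ∈ I) (c : R) :
    x * c ∈ I :=
  I.smul_mem (MulOpposite.op c) hx

theorem eq_zero_of_eq_mul_of_mem_jacobson {a b d : R} (hb : b ∈ Ring.jacobson R)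
    (h : d * b * a = a) : a = 0 := by
  rw [← Ideal.jacobson_bot, Ideal.mem_jacobson_iff] at hb
  obtain ⟨z, hz⟩ := hb (-d)
  rw [Ideal.mem_bot] at hz
  have hz' : z * (1 - d * b) = 1 := by
    rw [← sub_eq_zero, ← hz]; noncomm_ring
  calc a = z * (1 - d * b) * a := by rw [hz', one_mul]
    _ = z * (a - d * b * a) := by noncomm_ring
    _ = 0 := by rw [h, sub_self, mul_zero]

theorem PrincipalDCC.isNilpotent_jacobson [IsNoetherian Rᵐᵒᵖ R] (hD : PrincipalDCC R) :
    IsNilpotent (Ring.jacobson R) := by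
  set J := Ring.jacobson R
  let f : ℕ →o Submodule Rᵐᵒᵖ R :=
    ⟨fun n ↦ rightAnn (J ^ n : Ideal R), fun m n h ↦
      rightAnn_anti (s := ((J ^ n : Ideal R) : Set R)) (Ideal.pow_le_pow_right h)⟩
  obtain ⟨n₀, hn₀⟩ := monotone_stabilizes_iff_noetherian.mpr ‹IsNoetherian Rᵐᵒᵖ R› f
  -- A positive exponent ensures `J ^ n ≤ J`.
  obtain ⟨n, hn, hpos⟩ : ∃ n, (∀ m, n ≤ m → f n = f m) ∧ n ≠ 0 :=
    ⟨n₀ + 1, fun m hm ↦ (hn₀ _ (by lia)).symm.trans (hn₀ m (by lia)), by lia⟩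
  refine ⟨n, ?_⟩
  by_contra hne
  have hne' : ∃ a, a ∉ f n := by
    obtain ⟨k, hk, hk0⟩ := Submodule.exists_mem_ne_zero_of_ne_bot hne
    exact ⟨1, fun h ↦ hk0 (by simpa using h k hk)⟩
  obtain ⟨a, ha, hmin⟩ := hD _ hne'
  have hex : ∃ b ∈ J ^ n, b * a ∉ f n := by
    -- Otherwise `J ^ (2n)` kills `a`, and the chain is already stable at `n`.
    by_contra! hall
    apply ha
    rw [hn (n + n) (by lia)]
    have hle : J ^ n * J ^ n ≤ leftAnn {a} := Ideal.mul_le.mpr fun r hr s hs x hx ↦ by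
      rw [Set.mem_singleton_iff.mp hx, mul_assoc]
      exact hall s hs r hr
    intro x hx
    rw [SetLike.mem_coe, Ideal.IsTwoSided.pow_add] at hx
    exact hle hx a rfl
  obtain ⟨b, hb, hba⟩ := hex
  obtain ⟨d, hd⟩ := hmin b hba
  have : a = 0 := eq_zero_of_eq_mul_of_mem_jacobson (Ideal.pow_le_self hpos hb)
    (by rw [mul_assoc]; exact hd)
  exact ha (this ▸ zero_mem _)

theorem PrincipalDCC.of_surjective {S : Type v} [Ring S] (φ : R →+* S)
    (hφ : Function.Surjective φ) (hD : PrincipalDCC R) : PrincipalDCC S := by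
  rintro P ⟨s, hs⟩
  obtain ⟨r, rfl⟩ := hφ s
  obtain ⟨a, ha, hmin⟩ := hD (fun x ↦ P (φ x)) ⟨r, hs⟩
  refine ⟨φ a, ha, fun c hc ↦ ?_⟩
  obtain ⟨c, rfl⟩ := hφ c
  obtain ⟨d, hd⟩ := hmin c (by rwa [map_mul])
  exact ⟨φ d, by rw [← map_mul, ← map_mul, hd]⟩

theorem PrincipalDCC.exists_isSimpleModule_le (hD : PrincipalDCC R) {m : Ideal R} (hm : m ≠ ⊥) :
    ∃ I ≤ m, IsSimpleModule R I := by
  obtain ⟨x, hx, hx0⟩ := Submodule.exists_mem_ne_zero_of_ne_bot hm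
  obtain ⟨a, ⟨ha, ha0⟩, hmin⟩ := hD (fun a ↦ a ∈ m ∧ a ≠ 0) ⟨x, hx, hx0⟩
  refine ⟨Ideal.span {a}, (Ideal.span_singleton_le_iff_mem _).mpr ha, ?_⟩
  rw [isSimpleModule_iff_isAtom]
  refine ⟨fun h ↦ ha0 (Ideal.span_singleton_eq_bot.mp h), fun K hK ↦ ?_⟩
  by_contra hK0
  obtain ⟨y, hy, hy0⟩ := Submodule.exists_mem_ne_zero_of_ne_bot hK0
  obtain ⟨c, rfl⟩ := Ideal.mem_span_singleton'.mp (hK.le hy)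
  obtain ⟨d, hd⟩ := hmin c ⟨m.mul_mem_left c ha, hy0⟩
  refine hK.not_ge ((Ideal.span_singleton_le_iff_mem _).mpr ?_)
  exact hd ▸ Ideal.mul_mem_left K d hy

/-- Take `a` minimal with `N + Ra = R` for some semisimple `N`. If `a ≠ 0`, a simple `I ≤ Ra` has a
maximal complement `n`, as `J = 0`. Moving `I` into `N` replaces `a` by its component in `n`, and
minimality puts `a` in `n`, so `I ≤ n`. -/
theorem PrincipalDCC.isSemisimpleRing (hD : PrincipalDCC R) (hJ : Ring.jacobson R = ⊥) :
    IsSemisimpleRing R := by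
  obtain ⟨a, ⟨N, hN, hNa⟩, hmin⟩ := hD
    (fun a ↦ ∃ N : Ideal R, IsSemisimpleModule R N ∧ N ⊔ Ideal.span {a} = ⊤)
    ⟨1, ⊥, { exists_isCompl := fun K ↦ ⟨⊤, Subsingleton.elim K ⊥ ▸ isCompl_bot_top⟩ }, by
      rw [Ideal.span_singleton_one, bot_sup_eq]⟩
  suffices h : a = 0 by
    subst h
    rw [Ideal.span_singleton_eq_bot.mpr rfl, sup_bot_eq] at hNa
    subst hNa
    exact IsSemisimpleModule.congr (Submodule.topEquiv (R := R) (M := R)).symm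
  by_contra ha0
  obtain ⟨I, hIa, hI⟩ := hD.exists_isSimpleModule_le
    (m := Ideal.span {a}) (fun h ↦ ha0 (Ideal.span_singleton_eq_bot.mp h))
  have hIatom := isSimpleModule_iff_isAtom.mp hI
  obtain ⟨n, hn, hIn⟩ : ∃ n : Ideal R, IsCoatom n ∧ ¬ I ≤ n := by
    by_contra! hall
    exact hIatom.1 (le_bot_iff.mp (hJ ▸ le_sInf fun n hn ↦ hall n hn))
  have htop : I ⊔ n = ⊤ := hn.2 _ (right_lt_sup.mpr hIn)
  have hbot : I ⊓ n = ⊥ := hIatom.2 _ (inf_lt_left.mpr hIn)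
  obtain ⟨i, hi, a', ha', hsum⟩ := Submodule.mem_sup.mp (htop ▸ Submodule.mem_top : a ∈ I ⊔ n)
  have hia : i ∈ Ideal.span {a} := hIa hi
  obtain ⟨c, hc⟩ : ∃ c, c * a = a' := by
    rw [← Ideal.mem_span_singleton', ← sub_eq_iff_eq_add'.mpr hsum.symm]
    exact sub_mem (Ideal.mem_span_singleton_self a) hia
  obtain ⟨d, hd⟩ := hmin c ⟨N ⊔ I, IsSemisimpleModule.sup hN inferInstance, by
    rw [hc, ← top_le_iff, ← hNa]
    refine sup_le (le_sup_left.trans le_sup_left) ((Ideal.span_singleton_le_iff_mem _).mpr ?_)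
    rw [← hsum]
    exact add_mem (Submodule.mem_sup_left (Submodule.mem_sup_right hi))
      (Submodule.mem_sup_right (Ideal.mem_span_singleton_self _))⟩
  have han : a ∈ n := by rw [← hd, hc]; exact n.mul_mem_left d ha'
  exact hIn (hIa.trans ((Ideal.span_singleton_le_iff_mem _).mpr han))

theorem PrincipalDCC.isSemiprimaryRing [IsNoetherian Rᵐᵒᵖ R] (hD : PrincipalDCC R) :
    IsSemiprimaryRing R where
  isSemisimpleRing := (hD.of_surjective (Ideal.Quotient.mk (Ring.jacobson R))
    Ideal.Quotient.mk_surjective).isSemisimpleRing (Ring.jacobson_quotient_jacobson R)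
  isNilpotent := hD.isNilpotent_jacobson

/-- The kernel of `Rᵐᵒᵖ → (R/J)ᵐᵒᵖ` is nilpotent with semisimple quotient, so it is the Jacobson
radical of `Rᵐᵒᵖ`. -/
theorem IsSemiprimaryRing.op [hR : IsSemiprimaryRing R] : IsSemiprimaryRing Rᵐᵒᵖ := by
  let φ : Rᵐᵒᵖ →+* (R ⧸ Ring.jacobson R)ᵐᵒᵖ := (Ideal.Quotient.mk (Ring.jacobson R)).op
  have hφ : Function.Surjective φ := fun s ↦ by
    obtain ⟨r, hr⟩ := Ideal.Quotient.mk_surjective s.unop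
    exact ⟨MulOpposite.op r, MulOpposite.unop_injective hr⟩
  have hmem (x : Rᵐᵒᵖ) : x ∈ RingHom.ker φ ↔ x.unop ∈ Ring.jacobson R := by
    rw [RingHom.mem_ker, ← Ideal.Quotient.eq_zero_iff_mem, ← MulOpposite.unop_eq_zero_iff]
    rfl
  obtain ⟨n, hn⟩ := hR.isNilpotent
  have hpow (k : ℕ) : ∀ x ∈ RingHom.ker φ ^ k, x.unop ∈ Ring.jacobson R ^ k := by
    induction k with
    | zero => simp [Submodule.pow_zero, Ideal.one_eq_top]
    | succ k ih =>
      let T : AddSubgroup Rᵐᵒᵖ := ((Ring.jacobson R ^ (k + 1)).toAddSubgroup).comap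
        (MulOpposite.opAddEquiv (α := R)).symm.toAddMonoidHom
      intro x hx
      rw [Submodule.pow_succ] at hx
      refine Submodule.mul_induction_on hx (fun a ha b hb ↦ ?_) fun a b ha hb ↦ ?_
      · rw [MulOpposite.unop_mul, Ideal.IsTwoSided.pow_succ]
        exact Ideal.mul_mem_mul ((hmem b).mp hb) (ih a ha)
      · exact add_mem ha hb
  have hker : RingHom.ker φ ^ n = ⊥ := le_bot_iff.mp fun x hx ↦ by
    have := hpow n x hx
    rw [hn] at this
    exact MulOpposite.unop_injective this
  have hle : Ring.jacobson Rᵐᵒᵖ ≤ RingHom.ker φ := by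
    have : RingHomSurjective φ := ⟨hφ⟩
    refine (Ring.le_comap_jacobson φ).trans ?_
    rw [show Ring.jacobson (R ⧸ Ring.jacobson R)ᵐᵒᵖ = ⊥ from
      IsSemisimpleModule.jacobson_eq_bot _ _]
    exact le_rfl
  have hge : RingHom.ker φ ≤ Ring.jacobson Rᵐᵒᵖ := fun x hx ↦ by
    rw [← Ideal.jacobson_bot, Ideal.mem_jacobson_iff]
    intro y
    have hnil : IsNilpotent (y * x) := ⟨n, by
      have := Ideal.pow_mem_pow ((RingHom.ker φ).mul_mem_left y hx) n
      rwa [hker] at this⟩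
    obtain ⟨u, hu⟩ := hnil.isUnit_add_one
    refine ⟨↑u⁻¹, ?_⟩
    have : (↑u⁻¹ : Rᵐᵒᵖ) * (y * x + 1) = 1 := by rw [← hu, Units.inv_mul]
    rw [Ideal.mem_bot, ← sub_eq_zero.mpr this]
    noncomm_ring
  have heq : Ring.jacobson Rᵐᵒᵖ = RingHom.ker φ := le_antisymm hle hge
  refine ⟨?_, n, by rw [heq, hker, Ideal.zero_eq_bot]⟩
  exact ((Ideal.quotEquivOfEq heq).trans
    (RingHom.quotientKerEquivOfSurjective hφ)).symm.isSemisimpleRing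

/-! ### Annihilators under right self-injectivity, and chain conditions. -/

/-- Left multiplication as an endomorphism of the regular right module. -/
def mulLeftOp (a : R) : R →ₗ[Rᵐᵒᵖ] R := DistribSMul.toLinearMap Rᵐᵒᵖ R a

theorem LinearMap.apply_eq_apply_one_mul (f : R →ₗ[Rᵐᵒᵖ] R) (x : R) : f x = f 1 * x := by
  rw [← MulOpposite.unop_op x, ← MulOpposite.smul_eq_mul_unop, ← map_smul,
    MulOpposite.smul_eq_mul_unop, one_mul]

theorem LinearMap.apply_eq_sum_mul {ι : Type v} [Fintype ι] [DecidableEq ι]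
    (g : (ι → R) →ₗ[Rᵐᵒᵖ] R) (v : ι → R) : g v = ∑ i, g (Pi.single i 1) * v i := by
  conv_lhs => rw [← Finset.univ_sum_single v, map_sum]
  refine Finset.sum_congr rfl fun i _ ↦ ?_
  exact (g ∘ₗ LinearMap.single Rᵐᵒᵖ (fun _ ↦ R) i).apply_eq_apply_one_mul (v i)

/-- Multiplication by `b` factors through the image of `x ↦ (a i * x)` in `ι → R`; an extension `g`
to the whole power has coordinates expressing `b` as a left combination of the `a i`. -/
theorem mem_span_range_of_rightAnn_le (hR : Module.Baer Rᵐᵒᵖ R) {ι : Type v} [Finite ι]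
    (a : ι → R) (b : R) (h : ∀ x, (∀ i, a i * x = 0) → b * x = 0) :
    b ∈ Ideal.span (Set.range a) := by
  classical
  have := Fintype.ofFinite ι
  let F : R →ₗ[Rᵐᵒᵖ] (ι → R) := LinearMap.pi fun i ↦ mulLeftOp (a i)
  have hF (x : R) : x ∈ LinearMap.ker F ↔ ∀ i, a i * x = 0 := by
    rw [LinearMap.mem_ker, funext_iff]; rfl
  obtain ⟨g, hg⟩ := hR.extension_property ((LinearMap.ker F).liftQ F le_rfl)
    (LinearMap.ker_eq_bot.mp (Submodule.ker_liftQ_eq_bot _ _ _ le_rfl))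
    ((LinearMap.ker F).liftQ (mulLeftOp b) fun x hx ↦ h x ((hF x).mp hx))
  have h1 : g (F 1) = b := by
    have : g (F 1) = mulLeftOp b 1 := LinearMap.congr_fun hg ((LinearMap.ker F).mkQ 1)
    exact this.trans (mul_one b)
  rw [← h1, g.apply_eq_sum_mul]
  refine sum_mem fun i _ ↦ Ideal.mul_mem_left _ _ (Ideal.subset_span ⟨i, ?_⟩)
  exact (mul_one _).symm

theorem exists_eq_mul_of_rightAnn_le (hR : Module.Baer Rᵐᵒᵖ R) {a b : R}
    (h : ∀ x, a * x = 0 → b * x = 0) : ∃ c, c * a = b := by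
  have := mem_span_range_of_rightAnn_le hR (fun _ : Unit ↦ a) b fun x hx ↦ h x (hx ())
  rwa [Set.range_const, Ideal.mem_span_singleton'] at this

theorem leftAnn_rightAnn_of_fg (hR : Module.Baer Rᵐᵒᵖ R) {L : Ideal R} (hL : L.FG) :
    leftAnn (rightAnn (L : Set R) : Set R) = L := by
  refine le_antisymm (fun b hb ↦ ?_) fun x hx y hy ↦ hy x hx
  obtain ⟨s, rfl⟩ := hL
  have := mem_span_range_of_rightAnn_le hR (fun i : s ↦ (i : R)) b fun x hx ↦ hb x fun a ha ↦ by
    have hle : Submodule.span R (s : Set R) ≤ leftAnn {x} :=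
      Submodule.span_le.mpr fun c hc y hy ↦ Set.mem_singleton_iff.mp hy ▸ hx ⟨c, hc⟩
    exact hle ha x rfl
  simpa [Ideal.span] using this

theorem principalDCC_of_baer [IsNoetherian Rᵐᵒᵖ R] (hR : Module.Baer Rᵐᵒᵖ R) :
    PrincipalDCC R := by
  rintro P ⟨x, hx⟩
  obtain ⟨_, ⟨a, ha, rfl⟩, hmax⟩ := set_has_maximal_iff_noetherian.mpr ‹IsNoetherian Rᵐᵒᵖ R›
    {I | ∃ a, P a ∧ rightAnn {a} = I} ⟨_, x, hx, rfl⟩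
  refine ⟨a, ha, fun c hc ↦ exists_eq_mul_of_rightAnn_le hR fun y hy ↦ ?_⟩
  have hle : rightAnn {a} ≤ rightAnn {c * a} := fun z hz b hb ↦ by
    rw [Set.mem_singleton_iff.mp hb, mul_assoc, hz a rfl, mul_zero]
  have := eq_of_le_of_not_lt hle (hmax _ ⟨_, hc, rfl⟩)
  have hy' : y ∈ rightAnn {a} := this ▸ fun b hb ↦ Set.mem_singleton_iff.mp hb ▸ hy
  exact hy' a rfl

theorem isArtinian_op [IsNoetherian Rᵐᵒᵖ R] [IsSemiprimaryRing R] : IsArtinian Rᵐᵒᵖ R :=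
  have : IsSemiprimaryRing Rᵐᵒᵖ := IsSemiprimaryRing.op
  IsSemiprimaryRing.isNoetherian_iff_isArtinian.mp ‹_›

/-- A finitely generated `K ≤ L` with minimal right annihilator cannot grow, since it is recovered
from that annihilator. -/
theorem isNoetherianRing_of_isArtinian_op [IsArtinian Rᵐᵒᵖ R] (hR : Module.Baer Rᵐᵒᵖ R) :
    IsNoetherianRing R := by
  refine isNoetherianRing_iff_ideal_fg R |>.mpr fun L ↦ ?_
  obtain ⟨_, ⟨K, ⟨hKL, hK⟩, rfl⟩, hmin⟩ := IsArtinian.set_has_minimal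
    {I : Submodule Rᵐᵒᵖ R | ∃ K : Ideal R, (K ≤ L ∧ K.FG) ∧ rightAnn (K : Set R) = I}
    ⟨_, ⊥, ⟨bot_le, Submodule.fg_bot⟩, rfl⟩
  suffices h : L ≤ K from (le_antisymm hKL h) ▸ hK
  intro x hx
  have hK' : (K ⊔ Ideal.span {x}).FG := Submodule.FG.sup hK ⟨{x}, by simp [Ideal.span]⟩
  have := eq_of_le_of_not_lt
    (rightAnn_anti (SetLike.coe_subset_coe.mpr (le_sup_left : K ≤ K ⊔ Ideal.span {x})))
    (hmin _ ⟨_, ⟨sup_le hKL ((Ideal.span_singleton_le_iff_mem _).mpr hx), hK'⟩, rfl⟩)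
  rw [← leftAnn_rightAnn_of_fg hR hK, ← this, leftAnn_rightAnn_of_fg hR hK']
  exact Submodule.mem_sup_right (Ideal.mem_span_singleton_self x)

end

/-! ### Two-sided primes and simple right ideals. -/

/-- A two-sided ideal that is prime in the sense of noncommutative rings. -/
structure IsTwoSidedPrime {R : Type u} [Ring R] (P : Ideal R) : Prop where
  isTwoSided : P.IsTwoSided
  ne_top : P ≠ ⊤
  mem_or_mem : ∀ a b, (∀ r, a * r * b ∈ P) → a ∈ P ∨ b ∈ P

/-- The annihilator of the right module generated by `a`. -/
def cyclicRightAnn {R : Type u} [Ring R] (a : R) : Ideal R where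
  carrier := {x | ∀ r, a * r * x = 0}
  add_mem' hx hy r := by rw [mul_add, hx r, hy r, add_zero]
  zero_mem' _ := mul_zero _
  smul_mem' c x hx r := by rw [smul_eq_mul, ← mul_assoc, mul_assoc a, hx]

section

variable {R : Type u} [Ring R]

theorem mem_cyclicRightAnn {a x : R} : x ∈ cyclicRightAnn a ↔ ∀ r, a * r * x = 0 := Iff.rfl

instance (a : R) : (cyclicRightAnn a).IsTwoSided :=
  ⟨fun b hx r ↦ by rw [← mul_assoc, hx r, zero_mul]⟩

namespace IsTwoSidedPrime

theorem exists_le_of_inf_le {P : Ideal R} (hP : IsTwoSidedPrime P) (s : Finset (Ideal R))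
    (hs : ∀ I ∈ s, I.IsTwoSided) (h : s.inf id ≤ P) : ∃ I ∈ s, I ≤ P := by
  classical
  induction s using Finset.induction_on with
  | empty => exact (hP.ne_top (top_le_iff.mp h)).elim
  | insert I s _ ih =>
    by_cases hI : I ≤ P
    · exact ⟨I, Finset.mem_insert_self _ _, hI⟩
    obtain ⟨x, hx, hxP⟩ := SetLike.not_le_iff_exists.mp hI
    obtain ⟨K, hK, hKP⟩ := ih (fun K hK ↦ hs K (Finset.mem_insert_of_mem hK)) fun y hy ↦
      (hP.mem_or_mem x y fun r ↦ h (by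
        have := hs I (Finset.mem_insert_self _ _)
        rw [Finset.inf_insert]
        exact ⟨I.mul_mem_right _ (I.mul_mem_right _ hx), Ideal.mul_mem_left _ _ hy⟩)).resolve_left
        hxP
    exact ⟨K, Finset.mem_insert_of_mem hK, hKP⟩

theorem jacobson_le [hR : IsSemiprimaryRing R] {P : Ideal R} (hP : IsTwoSidedPrime P) :
    Ring.jacobson R ≤ P := by
  have := hP.isTwoSided
  obtain ⟨n, hn⟩ := hR.isNilpotent
  have key (k : ℕ) (hk : Ring.jacobson R ^ k ≤ P) : Ring.jacobson R ≤ P := by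
    induction k with
    | zero =>
      rw [Submodule.pow_zero, Ideal.one_eq_top, top_le_iff] at hk
      exact (hP.ne_top hk).elim
    | succ k ih =>
      by_cases hJ : Ring.jacobson R ≤ P
      · exact hJ
      obtain ⟨x, hx, hxP⟩ := SetLike.not_le_iff_exists.mp hJ
      refine ih fun y hy ↦ (hP.mem_or_mem x y fun r ↦ hk ?_).resolve_left hxP
      rw [Ideal.IsTwoSided.pow_succ]
      exact Ideal.mul_mem_mul (Ideal.mul_mem_right _ _ hx) hy
  exact key n (hn ▸ bot_le)

/-- Modulo `J` the ideal `Q` is generated by an idempotent `e`, so `Q (1 - e) ≤ J ≤ P`; primeness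
leaves `Q ≤ P`, as `1 - e ∈ P` would give `1 ∈ Q`. -/
theorem le_of_le [IsSemiprimaryRing R] {P : Ideal R} (hP : IsTwoSidedPrime P)
    {Q : Ideal R} [Q.IsTwoSided] (hQ : Q ≠ ⊤) (hPQ : P ≤ Q) : Q ≤ P := by
  obtain ⟨e, he, hspan⟩ := IsSemisimpleRing.ideal_eq_span_idempotent
    (Q.map (Ideal.Quotient.mk (Ring.jacobson R)))
  have hemem : e ∈ Q.map (Ideal.Quotient.mk (Ring.jacobson R)) :=
    hspan ▸ Ideal.mem_span_singleton_self e
  obtain ⟨e, heQ, rfl⟩ := (Ideal.mem_map_iff_of_surjective _ Ideal.Quotient.mk_surjective).mp hemem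
  have hmul (x : R) (hx : x ∈ Q) : x * (1 - e) ∈ Ring.jacobson R := by
    have := Ideal.mem_map_of_mem (Ideal.Quotient.mk (Ring.jacobson R)) hx
    rw [hspan, Ideal.mem_span_singleton'] at this
    obtain ⟨y, hy⟩ := this
    rw [← Ideal.Quotient.eq_zero_iff_mem, map_mul, ← hy, map_sub, map_one, mul_assoc, mul_sub,
      mul_one, he.eq, sub_self, mul_zero]
  intro x hx
  refine (hP.mem_or_mem x (1 - e) fun r ↦
    hP.jacobson_le (hmul _ (Q.mul_mem_right r hx))).resolve_right fun h ↦ hQ ?_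
  rw [Ideal.eq_top_iff_one, ← sub_add_cancel 1 e]
  exact add_mem (hPQ h) heQ

theorem eq_of_le [IsSemiprimaryRing R] {P Q : Ideal R} (hP : IsTwoSidedPrime P)
    (hQ : IsTwoSidedPrime Q) (h : P ≤ Q) : P = Q :=
  have := hQ.isTwoSided
  le_antisymm h (hP.le_of_le hQ.ne_top h)

end IsTwoSidedPrime

/-- A minimal finite intersection of primes lies below every prime, so each prime contains, hence
equals, one of the primes intersected. -/
theorem finite_setOf_isTwoSidedPrime [IsSemiprimaryRing R] [IsArtinianRing R] :
    {P : Ideal R | IsTwoSidedPrime P}.Finite := by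
  classical
  obtain ⟨_, ⟨s, hs, rfl⟩, hmin⟩ := IsArtinian.set_has_minimal
    {I : Ideal R | ∃ s : Finset (Ideal R), (∀ P ∈ s, IsTwoSidedPrime P) ∧ s.inf id = I}
    ⟨_, ∅, by simp, rfl⟩
  refine s.finite_toSet.subset fun P hP ↦ ?_
  have hle : s.inf id ≤ P := by
    have h := hmin _ ⟨insert P s, Finset.forall_mem_insert _ _ _ |>.mpr ⟨hP, hs⟩, rfl⟩
    rw [← eq_of_le_of_not_lt (Finset.inf_mono (Finset.subset_insert P s)) h, Finset.inf_insert]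
    exact inf_le_left
  obtain ⟨I, hI, hIP⟩ := hP.exists_le_of_inf_le s (fun I hI ↦ (hs I hI).isTwoSided) hle
  exact (hs I hI).eq_of_le hP hIP ▸ hI

theorem exists_isTwoSidedPrime_cyclicRightAnn [IsNoetherianRing R] {I : Submodule Rᵐᵒᵖ R}
    (hI : I ≠ ⊥) : ∃ a ∈ I, a ≠ 0 ∧ IsTwoSidedPrime (cyclicRightAnn a) := by
  obtain ⟨x, hx, hx0⟩ := Submodule.exists_mem_ne_zero_of_ne_bot hI
  obtain ⟨_, ⟨a, ⟨ha, ha0⟩, rfl⟩, hmax⟩ := set_has_maximal_iff_noetherian.mpr ‹IsNoetherianRing R›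
    {Q | ∃ a, (a ∈ I ∧ a ≠ 0) ∧ cyclicRightAnn a = Q} ⟨_, x, ⟨hx, hx0⟩, rfl⟩
  refine ⟨a, ha, ha0, inferInstance, fun h ↦ ha0 ?_, fun x y hxy ↦ ?_⟩
  · simpa using (h ▸ Submodule.mem_top : (1 : R) ∈ cyclicRightAnn a) 1
  · refine or_iff_not_imp_left.mpr fun hxa ↦ ?_
    rw [mem_cyclicRightAnn] at hxa
    push Not at hxa
    obtain ⟨s, hs⟩ := hxa
    have hle : cyclicRightAnn a ≤ cyclicRightAnn (a * s * x) := fun z hz r ↦ by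
      simpa [mul_assoc] using hz (s * x * r)
    rw [eq_of_le_of_not_lt hle (hmax _ ⟨_, ⟨I.mul_mem_of_op (I.mul_mem_of_op ha s) x, hs⟩, rfl⟩)]
    intro r
    have := hxy r s
    simpa [mul_assoc] using this

/-- Such a `y` generates a simple right submodule of `R/Q`. -/
theorem exists_minimal_notMem [IsArtinian Rᵐᵒᵖ R] {Q : Ideal R} [Q.IsTwoSided] (hQ : Q ≠ ⊤) :
    ∃ y ∉ Q, ∀ s, y * s ∉ Q → ∃ z, y - y * s * z ∈ Q := by
  let Q' : Submodule Rᵐᵒᵖ R :=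
    { Q.toAddSubmonoid with smul_mem' := fun c x hx ↦ Q.mul_mem_right c.unop hx }
  obtain ⟨_, ⟨y, hy, rfl⟩, hmin⟩ := IsArtinian.set_has_minimal
    {I | ∃ y, y ∉ Q ∧ Submodule.span Rᵐᵒᵖ {y} ⊔ Q' = I}
    ⟨_, 1, (Ideal.ne_top_iff_one Q).mp hQ, rfl⟩
  refine ⟨y, hy, fun s hs ↦ ?_⟩
  have hle : Submodule.span Rᵐᵒᵖ {y * s} ⊔ Q' ≤ Submodule.span Rᵐᵒᵖ {y} ⊔ Q' :=
    sup_le_sup_right ((Submodule.span_singleton_le_iff_mem _ _).mpr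
      (Submodule.mul_mem_of_op (Submodule.mem_span_singleton_self y) s)) _
  have heq := eq_of_le_of_not_lt hle (hmin _ ⟨_, hs, rfl⟩)
  have hmem : y ∈ Submodule.span Rᵐᵒᵖ {y * s} ⊔ Q' :=
    heq ▸ Submodule.mem_sup_left (Submodule.mem_span_singleton_self y)
  obtain ⟨w, hw, q, hq, hsum⟩ := Submodule.mem_sup.mp hmem
  obtain ⟨z, rfl⟩ := Submodule.mem_span_singleton.mp hw
  refine ⟨z.unop, ?_⟩
  rw [← MulOpposite.smul_eq_mul_unop, sub_eq_iff_eq_add'.mpr hsum.symm]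
  exact hq

theorem mul_eq_zero_iff_of_minimal {a u y : R} (hu : a * u * y ≠ 0)
    (hy : ∀ s, y * s ∉ cyclicRightAnn a → ∃ z, y - y * s * z ∈ cyclicRightAnn a) (t : R) :
    a * u * y * t = 0 ↔ y * t ∈ cyclicRightAnn a := by
  refine ⟨fun h ↦ ?_, fun h ↦ by rw [mul_assoc]; exact h u⟩
  by_contra ht
  obtain ⟨z, hz⟩ := hy t ht
  have := hz u
  rw [mul_sub, ← mul_assoc, ← mul_assoc, h, zero_mul, sub_zero] at this
  exact hu this

/-- `a * u * y` and `a' * u' * y` have the same right annihilator, so the second is a left multiple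
of the first. Both `P` and `P'` then kill it from the left; `P ⊔ P'` is proper and primes are
maximal. -/
theorem IsTwoSidedPrime.eq_of_cyclicRightAnn_eq [IsSemiprimaryRing R] [IsArtinian Rᵐᵒᵖ R]
    (hR : Module.Baer Rᵐᵒᵖ R) {P P' : Ideal R} (hP : IsTwoSidedPrime P) (hP' : IsTwoSidedPrime P')
    {a a' : R} (ha : a ∈ rightAnn (P : Set R)) (ha' : a' ∈ rightAnn (P' : Set R))
    (hQ : IsTwoSidedPrime (cyclicRightAnn a)) (h : cyclicRightAnn a = cyclicRightAnn a') :
    P = P' := by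
  obtain ⟨y, hyQ, hy⟩ := exists_minimal_notMem hQ.ne_top
  have hyQ' := h ▸ hyQ
  rw [mem_cyclicRightAnn] at hyQ hyQ'
  push Not at hyQ hyQ'
  obtain ⟨u, hu⟩ := hyQ
  obtain ⟨u', hu'⟩ := hyQ'
  obtain ⟨c, hc⟩ := exists_eq_mul_of_rightAnn_le hR (a := a * u * y) (b := a' * u' * y)
    fun t ht ↦ by
      rw [mul_eq_zero_iff_of_minimal hu' (h ▸ hy), ← h]
      exact (mul_eq_zero_iff_of_minimal hu hy t).mp ht
  have := hP.isTwoSided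
  have := hP'.isTwoSided
  have hle : P ⊔ P' ≤ leftAnn {a' * u' * y} := by
    refine sup_le (fun p hp b hb ↦ ?_) fun p hp b hb ↦ ?_ <;> rw [Set.mem_singleton_iff.mp hb]
    · rw [← hc, ← mul_assoc, mul_assoc a, ← mul_assoc, ha _ (P.mul_mem_right c hp), zero_mul]
    · rw [mul_assoc a', ← mul_assoc, ha' p hp, zero_mul]
  have hne : P ⊔ P' ≠ ⊤ := fun htop ↦ hu' <| by
    simpa using hle (htop ▸ Submodule.mem_top : (1 : R) ∈ P ⊔ P') _ rfl
  have hsup : (P ⊔ P').IsTwoSided := ⟨fun b hx ↦ by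
    obtain ⟨p, hp, q, hq, rfl⟩ := Submodule.mem_sup.mp hx
    rw [add_mul]
    exact add_mem (Submodule.mem_sup_left (P.mul_mem_right b hp))
      (Submodule.mem_sup_right (P'.mul_mem_right b hq))⟩
  exact le_antisymm (le_sup_left.trans (hP'.le_of_le hne le_sup_right))
    (le_sup_right.trans (hP.le_of_le hne le_sup_left))

/-- Sending `P` to a prime annihilator of a cyclic right submodule of `rightAnn P` is an injective
self-map of a finite set, hence surjective. -/
theorem IsTwoSidedPrime.exists_cyclicRightAnn_eq [IsSemiprimaryRing R] [IsArtinian Rᵐᵒᵖ R]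
    [IsNoetherianRing R] (hR : Module.Baer Rᵐᵒᵖ R) {Q : Ideal R} (hQ : IsTwoSidedPrime Q) :
    ∃ a : R, cyclicRightAnn a = Q := by
  have : IsArtinianRing R := IsSemiprimaryRing.isNoetherian_iff_isArtinian.mp ‹_›
  have hex (P : {P : Ideal R // IsTwoSidedPrime P}) :
      ∃ a ∈ rightAnn (P.1 : Set R), a ≠ 0 ∧ IsTwoSidedPrime (cyclicRightAnn a) := by
    refine exists_isTwoSidedPrime_cyclicRightAnn fun h ↦ P.2.ne_top ?_
    rw [← leftAnn_rightAnn_of_fg hR (IsNoetherian.noetherian P.1), h, Ideal.eq_top_iff_one]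
    intro x hx
    rw [(Submodule.mem_bot _).mp hx, mul_zero]
  choose a ha _ hprime using hex
  let σ (P : {P : Ideal R // IsTwoSidedPrime P}) : {P : Ideal R // IsTwoSidedPrime P} :=
    ⟨cyclicRightAnn (a P), hprime P⟩
  have : Finite {P : Ideal R // IsTwoSidedPrime P} := finite_setOf_isTwoSidedPrime.to_subtype
  have hσ : Function.Injective σ := fun P P' h ↦ Subtype.ext <|
    P.2.eq_of_cyclicRightAnn_eq hR P'.2 (ha P) (ha P') (hprime P) (congrArg Subtype.val h)
  obtain ⟨P, hP⟩ := Finite.surjective_of_injective hσ ⟨Q, hQ⟩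
  exact ⟨a P, congrArg Subtype.val hP⟩

/-- The largest two-sided ideal contained in a right ideal. -/
def rightCore (m : Submodule Rᵐᵒᵖ R) : Ideal R where
  carrier := {x | ∀ r, r * x ∈ m}
  add_mem' hx hy r := by rw [mul_add]; exact add_mem (hx r) (hy r)
  zero_mem' r := by rw [mul_zero]; exact zero_mem m
  smul_mem' c x hx r := by rw [smul_eq_mul, ← mul_assoc]; exact hx _

theorem exists_one_sub_mul_mem {m : Submodule Rᵐᵒᵖ R} (hm : IsCoatom m) {x : R} (hx : x ∉ m) :
    ∃ z, 1 - x * z ∈ m := by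
  have htop : m ⊔ Submodule.span Rᵐᵒᵖ {x} = ⊤ := hm.2 _ <| left_lt_sup.mpr fun h ↦
    hx (h (Submodule.mem_span_singleton_self x))
  obtain ⟨k, hk, w, hw, hsum⟩ :=
    Submodule.mem_sup.mp (htop ▸ Submodule.mem_top : (1 : R) ∈ m ⊔ Submodule.span Rᵐᵒᵖ {x})
  obtain ⟨z, rfl⟩ := Submodule.mem_span_singleton.mp hw
  refine ⟨z.unop, ?_⟩
  rw [← MulOpposite.smul_eq_mul_unop, ← hsum, add_sub_cancel_right]
  exact hk

theorem one_notMem_of_isCoatom {m : Submodule Rᵐᵒᵖ R} (hm : IsCoatom m) : (1 : R) ∉ m :=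
  fun h ↦ hm.1 <| eq_top_iff.mpr fun x _ ↦ by simpa using m.mul_mem_of_op h x

theorem isTwoSidedPrime_rightCore {m : Submodule Rᵐᵒᵖ R} (hm : IsCoatom m) :
    IsTwoSidedPrime (rightCore m) where
  isTwoSided := ⟨fun b hx r ↦ by rw [← mul_assoc]; exact m.mul_mem_of_op (hx r) b⟩
  ne_top h := one_notMem_of_isCoatom hm <| by
    simpa using (h ▸ Submodule.mem_top : (1 : R) ∈ rightCore m) 1
  mem_or_mem x y hxy := by
    refine or_iff_not_imp_left.mpr fun hx r ↦ ?_
    obtain ⟨s, hs⟩ := not_forall.mp hx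
    obtain ⟨t, ht⟩ := exists_one_sub_mul_mem hm hs
    have h1 := m.mul_mem_of_op ht (r * y)
    have h2 := hxy (t * r) s
    have : r * y = (1 - s * x * t) * (r * y) + s * (x * (t * r) * y) := by noncomm_ring
    rw [this]
    exact add_mem h1 h2

theorem exists_mul_eq_zero_of_isCoatom [IsSemiprimaryRing R] [IsArtinian Rᵐᵒᵖ R]
    [IsNoetherianRing R] (hR : Module.Baer Rᵐᵒᵖ R) {m : Submodule Rᵐᵒᵖ R} (hm : IsCoatom m) :
    ∃ b ≠ 0, ∀ t ∈ m, b * t = 0 := by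
  have hQ := isTwoSidedPrime_rightCore hm
  obtain ⟨a, ha⟩ := hQ.exists_cyclicRightAnn_eq hR
  have := hQ.isTwoSided
  obtain ⟨y, hyQ, hy⟩ := exists_minimal_notMem hQ.ne_top
  obtain ⟨u, hu⟩ := not_forall.mp hyQ
  obtain ⟨z, hz⟩ := exists_one_sub_mul_mem hm hu
  have hyz : y * z ∉ cyclicRightAnn a := fun h ↦ one_notMem_of_isCoatom hm <| by
    rw [ha] at h
    simpa [mul_assoc] using add_mem hz (h u)
  obtain ⟨u', hu'⟩ := not_forall.mp hyz
  -- Left multiplication by `u` identifies the simple module generated by `y` modulo the core with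
  -- `R/m`, and `y * z` corresponds to `1`, so its annihilator is `m`.
  refine ⟨a * u' * (y * z), hu', fun t ht ↦ ?_⟩
  suffices h : y * z * t ∈ cyclicRightAnn a by rw [mul_assoc]; exact h u'
  rw [ha]
  by_contra h
  obtain ⟨w, hw⟩ := hy (z * t) (by rwa [← mul_assoc])
  have h1 : u * y * z * t ∈ m := by
    have : u * y * z * t = t - (1 - u * y * z) * t := by noncomm_ring
    rw [this]
    exact sub_mem ht (m.mul_mem_of_op hz t)
  have h2 := add_mem (hw u) (m.mul_mem_of_op h1 w)
  have : u * (y - y * (z * t) * w) + u * y * z * t * w = u * y := by noncomm_ring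
  exact hu (this ▸ h2)

end

/-! ### Embeddings into injective free modules, and extension reflection. -/

section

variable {S : Type u} [Ring S]

theorem Module.Baer.finsupp [IsNoetherianRing S] (hS : Module.Baer S S) (ι : Type v) :
    Module.Baer S (ι →₀ S) := by
  classical
  intro I g
  have hex (i : ι) : ∃ g' : S →ₗ[S] S, ∀ (x : S) (hx : x ∈ I), g' x = g ⟨x, hx⟩ i :=
    hS I (Finsupp.lapply i ∘ₗ g)
  choose c hc using hex
  obtain ⟨t, ht⟩ : ∃ t : Finset ι, LinearMap.range g ≤ Finsupp.supported S S (t : Set ι) := by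
    obtain ⟨s, hs⟩ : (LinearMap.range g).FG := by
      rw [LinearMap.range_eq_map]
      exact (IsNoetherian.noetherian (⊤ : Submodule S I)).map g
    refine ⟨s.biUnion Finsupp.support, hs ▸ Submodule.span_le.mpr fun f hf i hi ↦ ?_⟩
    exact Finset.mem_coe.mpr (Finset.mem_biUnion.mpr ⟨f, hf, hi⟩)
  refine ⟨∑ i ∈ t, Finsupp.lsingle i ∘ₗ c i, fun x hx ↦ ?_⟩
  ext j
  simp only [LinearMap.sum_apply, LinearMap.comp_apply, Finsupp.lsingle_apply,
    Finsupp.finsetSum_apply, Finsupp.single_apply, Finset.sum_ite_eq', hc j x hx]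
  split_ifs with hj
  · rfl
  · refine (Finsupp.notMem_support_iff.mp fun h ↦ hj ?_).symm
    exact ht ⟨_, rfl⟩ h

theorem IsSimpleModule.exists_injective_of_forall_isMaximal
    (hK : ∀ L : Ideal S, L.IsMaximal → ∃ b ≠ 0, ∀ t ∈ L, t * b = 0)
    (M : Type v) [AddCommGroup M] [Module S M] [IsSimpleModule S M] :
    ∃ f : M →ₗ[S] S, Function.Injective f := by
  obtain ⟨L, hL, ⟨e⟩⟩ := isSimpleModule_iff_quot_maximal.mp ‹IsSimpleModule S M›
  obtain ⟨b, hb, hLb⟩ := hK L hL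
  let f : M →ₗ[S] S := L.liftQ (LinearMap.toSpanSingleton S S b) hLb ∘ₗ e.toLinearMap
  refine ⟨f, LinearMap.injective_of_ne_zero fun h ↦ hb ?_⟩
  have h1 : f (e.symm (L.mkQ 1)) = 1 * b := by
    rw [LinearMap.comp_apply, LinearEquiv.coe_coe, e.apply_symm_apply]
    rfl
  rw [← one_mul b, ← h1, h, LinearMap.zero_apply]

theorem exists_isSimpleModule_le_of_ne_bot [IsArtinianRing S] {M : Type v} [AddCommGroup M]
    [Module S M] {N : Submodule S M} (hN : N ≠ ⊥) : ∃ K ≤ N, IsSimpleModule S K := by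
  obtain ⟨x, hx, hx0⟩ := Submodule.exists_mem_ne_zero_of_ne_bot hN
  have : Nontrivial (Submodule.span S {x}) :=
    Submodule.nontrivial_iff_ne_bot.mpr fun h ↦ hx0 (Submodule.span_singleton_eq_bot.mp h)
  obtain ⟨K, hK, -⟩ := (eq_bot_or_exists_atom_le
    (⊤ : Submodule S (Submodule.span S {x}))).resolve_left top_ne_bot
  have : IsSimpleModule S K := isSimpleModule_iff_isAtom.mpr hK
  refine ⟨K.map (Submodule.subtype _), ?_, ?_⟩
  · exact (Submodule.map_subtype_le _ _).trans ((Submodule.span_singleton_le_iff_mem _ _).mpr hx)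
  · exact IsSimpleModule.congr (K.equivMapOfInjective _ (Submodule.injective_subtype _)).symm

/-- The socle embeds in a free module simple by simple. The extension to `M` stays injective because
over an artinian ring the socle is essential. -/
theorem exists_injective_finsupp [IsNoetherianRing S] [IsArtinianRing S] (hS : Module.Baer S S)
    (hK : ∀ L : Ideal S, L.IsMaximal → ∃ b ≠ 0, ∀ t ∈ L, t * b = 0)
    (M : Type v) [AddCommGroup M] [Module S M] :
    ∃ (ι : Type v) (f : M →ₗ[S] ι →₀ S), Function.Injective f := by
  classical
  let soc : Submodule S M := ⨆ N ∈ {N : Submodule S M | IsSimpleModule S N}, N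
  have hsoc : IsSemisimpleModule S soc :=
    isSemisimpleModule_biSup_of_isSemisimpleModule_submodule fun N hN ↦
      have : IsSimpleModule S N := hN
      inferInstance
  obtain ⟨s, e, -, hs⟩ := IsSemisimpleModule.exists_linearEquiv_dfinsupp S soc
  choose g hg using fun m : s ↦
    have := hs m
    IsSimpleModule.exists_injective_of_forall_isMaximal hK m.1
  let h : soc →ₗ[S] s →₀ S := (finsuppLequivDFinsupp S).symm.toLinearMap ∘ₗ
    DFinsupp.mapRange.linearMap g ∘ₗ e.toLinearMap
  have hh : Function.Injective h := (finsuppLequivDFinsupp S).symm.injective.comp <|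
    ((DFinsupp.mapRange_injective _ fun i ↦ map_zero (g i)).mpr hg).comp e.injective
  obtain ⟨f, hf⟩ := (hS.finsupp s).extension_property soc.subtype soc.injective_subtype h
  refine ⟨s, f, LinearMap.ker_eq_bot.mp ?_⟩
  by_contra hker
  obtain ⟨N, hN, hNs⟩ := exists_isSimpleModule_le_of_ne_bot hker
  have hNsoc : N ≤ soc := le_iSup₂_of_le (f := fun (N : Submodule S M) _ ↦ N) N hNs le_rfl
  obtain ⟨x, hx, hx0⟩ := Submodule.exists_mem_ne_zero_of_ne_bot (isSimpleModule_iff_isAtom.mp hNs).1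
  have hx' : h ⟨x, hNsoc hx⟩ = 0 := by
    rw [← hf]
    exact hN hx
  exact hx0 (congrArg Subtype.val (hh (hx'.trans (map_zero h).symm)))

theorem isSier_of_injective {M : Type v} [AddCommGroup M] [Module S M]
    {F : Type v} [AddCommGroup F] [Module S F] [Module.Projective S F]
    (hF : Module.Baer S F) (j : M →ₗ[S] F) (hj : Function.Injective j) :
    IsSier S M := by
  intro A B C _ _ _ _ _ _ i p hi hip hp hA hC N _ _ k hk f
  obtain ⟨g, hg⟩ := hC F j hj (p ∘ₗ f)
  obtain ⟨h, hh⟩ := Module.projective_lifting_property p g hp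
  -- The error `f - h ∘ j` dies in `C`, so it lands in `A` and extends to `F` by `hA`.
  have hker (x : M) : f x - h (j x) ∈ LinearMap.range i := by
    rw [LinearMap.mem_range, ← Set.mem_range, ← hip, map_sub, sub_eq_zero]
    exact (LinearMap.congr_fun hg x).symm.trans (LinearMap.congr_fun hh (j x)).symm
  let a : M →ₗ[S] A := (LinearEquiv.ofInjective i hi).symm.toLinearMap ∘ₗ
    (f - h ∘ₗ j).codRestrict _ hker
  have ha (x : M) : i (a x) = f x - h (j x) :=
    congrArg Subtype.val ((LinearEquiv.ofInjective i hi).apply_symm_apply ⟨_, hker x⟩)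
  obtain ⟨b, hb⟩ := hA F j hj a
  obtain ⟨l, hl⟩ := hF.extension_property k hk j
  refine ⟨(h + i ∘ₗ b) ∘ₗ l, LinearMap.ext fun x ↦ ?_⟩
  have hlx : l (k x) = j x := LinearMap.congr_fun hl x
  have hbx : b (j x) = a x := LinearMap.congr_fun hb x
  simp [hlx, hbx, ha]

theorem isSper_of_surjective {M : Type v} [AddCommGroup M] [Module S M] {F : Type v}
    [AddCommGroup F] [Module S F] [Module.Projective S F] (hF : Module.Baer S F)
    (q : F →ₗ[S] M) (hq : Function.Surjective q) : IsSper S M := by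
  intro A B C _ _ _ _ _ _ i p hi hip hp hA hC N _ _ k hk f
  obtain ⟨g, hg⟩ := hA F q hq (f ∘ₗ i)
  obtain ⟨h, hh⟩ := hF.extension_property i hi g
  have hker : LinearMap.ker p ≤ LinearMap.ker (f - q ∘ₗ h) := fun x hx ↦ by
    obtain ⟨y, rfl⟩ := (hip x).mp hx
    have h1 : h (i y) = g y := LinearMap.congr_fun hh y
    have h2 : q (g y) = f (i y) := LinearMap.congr_fun hg y
    simp [h1, h2]
  obtain ⟨c, hc⟩ : ∃ c : C →ₗ[S] M, c ∘ₗ p = f - q ∘ₗ h := by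
    refine ⟨(LinearMap.ker p).liftQ _ hker ∘ₗ (p.quotKerEquivOfSurjective hp).symm.toLinearMap,
      LinearMap.ext fun x ↦ ?_⟩
    have : (p.quotKerEquivOfSurjective hp).symm (p x) = (LinearMap.ker p).mkQ x := by
      rw [LinearEquiv.symm_apply_eq]; rfl
    simp only [LinearMap.comp_apply, LinearEquiv.coe_coe, this]
    rfl
  obtain ⟨d, hd⟩ := hC F q hq c
  obtain ⟨l, hl⟩ := Module.projective_lifting_property k q hk
  refine ⟨l ∘ₗ (h + d ∘ₗ p), LinearMap.ext fun x ↦ ?_⟩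
  have h1 (y : F) : k (l y) = q y := LinearMap.congr_fun hl y
  have h2 : q (d (p x)) = c (p x) := LinearMap.congr_fun hd (p x)
  have h3 : c (p x) = f x - q (h x) := LinearMap.congr_fun hc x
  simp only [LinearMap.comp_apply, LinearMap.add_apply, h1, map_add, h2, h3]
  abel

end

/-! ### Passage to left modules, and the theorem. -/

section

variable {R : Type u} [Ring R]

theorem exists_mul_eq_zero_of_isMaximal_op
    (hR : ∀ m : Submodule Rᵐᵒᵖ R, IsCoatom m → ∃ b ≠ 0, ∀ t ∈ m, b * t = 0)
    (L : Ideal Rᵐᵒᵖ) (hL : L.IsMaximal) : ∃ b ≠ 0, ∀ t ∈ L, t * b = 0 := by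
  let e : R ≃ₗ[Rᵐᵒᵖ] Rᵐᵒᵖ := MulOpposite.opLinearEquiv Rᵐᵒᵖ
  obtain ⟨b, hb, h⟩ := hR ((Submodule.orderIsoMapComap e).symm L)
    ((OrderIso.isCoatom_iff _ _).mpr (Ideal.isMaximal_def.mp hL))
  refine ⟨MulOpposite.op b, (MulOpposite.op_ne_zero_iff b).mpr hb, fun t ht ↦ ?_⟩
  exact MulOpposite.unop_injective (h t.unop ht)

theorem exists_linearMap_ne_zero [IsNoetherianRing Rᵐᵒᵖ] [IsArtinianRing Rᵐᵒᵖ]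
    (hR : Module.Baer Rᵐᵒᵖ Rᵐᵒᵖ)
    (hK : ∀ L : Ideal Rᵐᵒᵖ, L.IsMaximal → ∃ b ≠ 0, ∀ t ∈ L, t * b = 0)
    {M : Type v} [AddCommGroup M] [Module Rᵐᵒᵖ M] {x : M} (hx : x ≠ 0) :
    ∃ f : M →ₗ[Rᵐᵒᵖ] R, f x ≠ 0 := by
  obtain ⟨ι, f, hf⟩ := exists_injective_finsupp hR hK M
  obtain ⟨i, hi⟩ := Finsupp.ne_iff.mp ((map_ne_zero_iff f hf).mpr hx)
  let e : Rᵐᵒᵖ ≃ₗ[Rᵐᵒᵖ] R := (MulOpposite.opLinearEquiv Rᵐᵒᵖ).symm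
  exact ⟨e.toLinearMap ∘ₗ Finsupp.lapply i ∘ₗ f,
    fun h ↦ hi (e.injective (h.trans (map_zero e).symm))⟩

/-- Let `a` list generators of `L` and `b` their images under `g`. A functional vanishing on `a` is
a left linear relation among the generators; `g` preserves it, so it also vanishes on `b`.
Separation by functionals then forces `b = a * c`. -/
theorem baer_of_exists_linearMap_ne_zero [IsNoetherianRing R]
    (hR : ∀ (M : Type u) [AddCommGroup M] [Module Rᵐᵒᵖ M] (x : M), x ≠ 0 →
      ∃ f : M →ₗ[Rᵐᵒᵖ] R, f x ≠ 0) : Module.Baer R R := by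
  classical
  intro L g
  obtain ⟨s, hs⟩ := IsNoetherian.noetherian (⊤ : Submodule R L)
  let a : s → R := fun i ↦ i.1.1
  let b : s → R := fun i ↦ g i
  obtain ⟨c, hc⟩ : ∃ c : R, ∀ i, a i * c = b i := by
    let N : Submodule Rᵐᵒᵖ (s → R) := Submodule.span Rᵐᵒᵖ {a}
    suffices hb : b ∈ N by
      obtain ⟨c, hc⟩ := Submodule.mem_span_singleton.mp hb
      exact ⟨c.unop, fun i ↦ congrFun hc i⟩
    by_contra hb
    obtain ⟨f, hf⟩ := hR ((s → R) ⧸ N) (N.mkQ b)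
      (fun h ↦ hb ((Submodule.Quotient.mk_eq_zero N).mp h))
    let f' : (s → R) →ₗ[Rᵐᵒᵖ] R := f ∘ₗ N.mkQ
    have ha : f' a = 0 := by
      have : N.mkQ a = 0 :=
        (Submodule.Quotient.mk_eq_zero N).mpr (Submodule.mem_span_singleton_self a)
      rw [LinearMap.comp_apply, this, map_zero]
    have hsum : ∑ i, f' (Pi.single i 1) • i.1 = 0 := Subtype.ext <| by
      rw [f'.apply_eq_sum_mul] at ha
      simpa [a] using ha
    refine hf ?_
    change f' b = 0
    rw [f'.apply_eq_sum_mul, ← map_zero g, ← hsum, map_sum]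
    simp only [map_smul, smul_eq_mul, b]
  refine ⟨LinearMap.toSpanSingleton R R c, fun x hx ↦ ?_⟩
  have heq : LinearMap.toSpanSingleton R R c ∘ₗ L.subtype = g :=
    LinearMap.ext_on hs fun i hi ↦ hc ⟨i, hi⟩
  exact LinearMap.congr_fun heq ⟨x, hx⟩

end

theorem corollary2p13 (R : Type u) [Ring R] (hR : IsQFRing R) :
    (∀ (M : Type (max u v)) [AddCommGroup M] [Module Rᵐᵒᵖ M], IsSier Rᵐᵒᵖ M) ∧
    (∀ (M : Type (max u v)) [AddCommGroup M] [Module R M], IsSier R M) ∧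
    (∀ (M : Type (max u v)) [AddCommGroup M] [Module Rᵐᵒᵖ M], IsSper Rᵐᵒᵖ M) ∧
    (∀ (M : Type (max u v)) [AddCommGroup M] [Module R M], IsSper R M) := by
  have := hR.right_noetherian
  have hB : Module.Baer Rᵐᵒᵖ R := Module.Baer.of_injective hR.right_selfInjective
  have : IsSemiprimaryRing R := (principalDCC_of_baer hB).isSemiprimaryRing
  have : IsArtinian Rᵐᵒᵖ R := isArtinian_op
  have : IsNoetherianRing R := isNoetherianRing_of_isArtinian_op hB
  have : IsArtinianRing R := IsSemiprimaryRing.isNoetherian_iff_isArtinian.mp ‹_›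
  let e : R ≃ₗ[Rᵐᵒᵖ] Rᵐᵒᵖ := MulOpposite.opLinearEquiv Rᵐᵒᵖ
  have : IsNoetherianRing Rᵐᵒᵖ := isNoetherian_of_linearEquiv e
  have : IsArtinianRing Rᵐᵒᵖ := e.isArtinian_iff.mp ‹_›
  have hBop : Module.Baer Rᵐᵒᵖ Rᵐᵒᵖ := hB.of_equiv e
  have hKop := exists_mul_eq_zero_of_isMaximal_op fun m hm ↦ exists_mul_eq_zero_of_isCoatom hB hm
  have hBleft : Module.Baer R R := baer_of_exists_linearMap_ne_zero
    fun _ _ _ _ hx ↦ exists_linearMap_ne_zero hBop hKop hx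
  have hKleft (L : Ideal R) (hL : L.IsMaximal) : ∃ b ≠ 0, ∀ t ∈ L, t * b = 0 := by
    have hne : rightAnn (L : Set R) ≠ ⊥ := fun h ↦ hL.ne_top <| by
      rw [← leftAnn_rightAnn_of_fg hB (IsNoetherian.noetherian L), h, Ideal.eq_top_iff_one]
      exact fun x hx ↦ by rw [(Submodule.mem_bot _).mp hx, mul_zero]
    obtain ⟨b, hb, hb0⟩ := Submodule.exists_mem_ne_zero_of_ne_bot hne
    exact ⟨b, hb0, hb⟩
  refine ⟨fun M _ _ ↦ ?_, fun M _ _ ↦ ?_, fun M _ _ ↦ ?_, fun M _ _ ↦ ?_⟩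
  · obtain ⟨ι, f, hf⟩ := exists_injective_finsupp hBop hKop M
    exact isSier_of_injective (hBop.finsupp ι) f hf
  · obtain ⟨ι, f, hf⟩ := exists_injective_finsupp hBleft hKleft M
    exact isSier_of_injective (hBleft.finsupp ι) f hf
  · exact isSper_of_surjective (hBop.finsupp M) (Finsupp.linearCombination Rᵐᵒᵖ id)
      (Finsupp.linearCombination_id_surjective _ M)
  · exact isSper_of_surjective (hBleft.finsupp M) (Finsupp.linearCombination R id)
      (Finsupp.linearCombination_id_surjective _ M)
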